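/- Let $F(x)=\frac1n\sum_{i=1}^n f_i(x)+g(x)$ on $\mathbb{R}^d$ (Euclidean norm), where every $f_i:\mathbb{R}^d\to\mathbb{R}$ is convex and $G$-Lipschitz continuous ($G>0$) and $g:\mathbb{R}^d\to\mathbb{R}$ is convex, not necessarily strongly convex. Let $x^\star$ be a minimizer of $F$, let $\tilde x^0\in\mathbb{R}^d$ be a starting point, and put $\Delta=F(\tilde x^0)-F(x^\star)$. \textbf{ASVRG.} For differentiable $h_i$ and convex $\psi$, a round of ASVRG with $S$ epochs of length $m$, step size $\eta$, momentum $\omega$ and uniform sampling starts from $x^1_0=y^1_0=\tilde x^0$. In epoch $s=1,\dots,S$ it computes $\tilde\nabla=\frac1n\sum_i\nabla h_i(\tilde x^{s-1})$; for $t=1,\dots,m$ it draws $i$ uniformly from $\{1,\dots,n\}$, independently of the past, and sets $$v=\nabla h_i(x^s_{t-1})-\nabla h_i(\tilde x^{s-1})+\tilde\nabla,\qquad y^s_t=\arg\min_y\Big\{\langle v,y-y^s_{t-1}\rangle+\tfrac{\omega}{2\eta}\|y-y^s_{t-1}\|^2+\psi(y)\Big\},\qquad x^s_t=\tilde x^{s-1}+\omega(y^s_t-\tilde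 x^{s-1});$$ then $\tilde x^s=\frac1m\sum_{t=1}^m x^s_t$, $y^{s+1}_0=y^s_m$ and $x^{s+1}_0=(1-\omega)\tilde x^s+\omega y^s_m$. The round returns $\frac1S\sum_{s=1}^S\tilde x^s$, from which the next round is restarted. For $L$-smooth $h_i$ and $\mu$-strongly convex $\psi$ the parameters are $\eta=\frac1{3L}$, $\omega=\sqrt{\frac{m\mu}{3L}}$ if $\frac{m\mu}{L}\le\frac34$, and $\eta=\frac1{4m\mu}$, $\omega=\frac12$ otherwise, with $S=\big\lceil 2\big(\frac{1-\omega}{\omega}+\frac{\omega}{\eta m\mu}\big)\big\rceil$. \textbf{Adaptive regularization and smoothing.} In stage $t=0,1,\dots,T-1$, starting from the output of the previous stage ($\tilde x^0$ if $t=0$), run two rounds of ASVRG on $$\frac1n\sum_{i=1}^n f_i^{\delta_t}(x)+\Big[g(x)+\frac{\sigma_t}{2}\|x-\tilde x^0\|^2\Big],\qquad f_i^{\delta}(x)=\inf_y\Big\{f_i(y)+\frac{\delta}{2}\|x-y\|^2\Big\},$$ with $h_i=f_i^{\delta_t}$, $\psi$ the bracket, $L=\delta_t=2^t\,\frac{G^2}{\Delta}$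 and $\mu=\sigma_t=2^{-t}\frac{\Delta}{\|\tilde x^0-x^\star\|^2}$, and with $T=\lceil\log_2(4\Delta/\varepsilon)\rceil$ stages. Let $\hat x$ be the final output. \textbf{Claim.} Let $0<a\le b$ and $\kappa>1$. There is a constant $C>0$ depending only on $a,b,\kappa$ such that for all $n\ge1$, $d$, $f_i$, $g$, $G$, $x^\star$, $\tilde x^0$ as above, every epoch length $m$ with $an\le m\le bn$ and every $\varepsilon$ with $0<\varepsilon\le\Delta/\kappa$, the output is $\varepsilon$-suboptimal, i.e. $F(\hat x)$ is integrable and $$\mathbb{E}[F(\hat x)]-F(x^\star)\le\varepsilon,$$ and the oracle complexity, that is, the total number of evaluations of component gradients $\nabla f_i^{\delta_t}$ (with $n$ per full gradient and $2$ per stochastic update), is on every run at most $$C\left(n\log\frac{\Delta}{\varepsilon}+\frac{\sqrt n\,G\,\|\tilde x^0-x^\star\|}{\varepsilon}\right).$$ -/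

import Mathlib

open scoped BigOperators

noncomputable section

namespace ASVRG

/-- `ℝ^d` with its Euclidean norm and inner product. -/
abbrev Vec (d : ℕ) : Type := EuclideanSpace ℝ (Fin d)

/-- The composite finite-sum objective `F(x) = (1/n) ∑ᵢ fᵢ(x) + g(x)`. -/
def objective {d n : ℕ} (f : Fin n → Vec d → ℝ) (g : Vec d → ℝ) (x : Vec d) : ℝ :=
  (1 / (n : ℝ)) * ∑ i, f i x + g x

/-- The `δ`-Moreau envelope `h^δ(x) = inf_y { h(y) + (δ/2)‖x - y‖² }`. -/
def moreau {d : ℕ} (δ : ℝ) (h : Vec d → ℝ) (x : Vec d) : ℝ :=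
  ⨅ y : Vec d, (h y + δ / 2 * ‖x - y‖ ^ 2)

/-- A global minimizer of `h` (an arbitrary vector if `h` has none). -/
def argmin {d : ℕ} (h : Vec d → ℝ) : Vec d :=
  Classical.epsilon fun y => ∀ z, h y ≤ h z

/-- `k` consecutive runs of a randomized step; the random choices of different runs are
independent. -/
def iterLaw {α : Type} (step : α → PMF α) : ℕ → α → PMF α
  | 0, s => PMF.pure s
  | k + 1, s => (iterLaw step k s).bind step

/-- The inputs of ASVRG: number `S` of epochs, maximal epoch length `m`, first epoch length `m₁`,
growth factor `ρ` of the epoch lengths, step size `η`, momentum parameter `ω` and sampling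
distribution `P`. -/
structure Params (n : ℕ) where
  S : ℕ
  m : ℕ
  m₁ : ℕ
  ρ : ℝ
  η : ℝ
  ω : ℝ
  P : PMF (Fin n)

/-- State inside an epoch: `x = x^s_t`, `y = y^s_t`, `xSum = x^s_1 + ⋯ + x^s_t`, and the number of
component gradients evaluated so far. -/
structure InnerState (d : ℕ) where
  x : Vec d
  y : Vec d
  xSum : Vec d
  calls : ℕ

/-- State between two epochs: the snapshot `snap = x̃^s`, the starting points `x = x^{s+1}_0` and
`y = y^{s+1}_0` of the next epoch, `snapSum = x̃^1 + ⋯ + x̃^s`, the length `len = m_{s+1}` of the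
next epoch, and the number of component gradients evaluated so far. -/
structure OuterState (d : ℕ) where
  snap : Vec d
  x : Vec d
  y : Vec d
  snapSum : Vec d
  len : ℕ
  calls : ℕ

section Algorithm

variable {d n : ℕ} (f : Fin n → Vec d → ℝ) (g : Vec d → ℝ) (p : Params n)

/-- The variance reduced gradient estimator
`[∇fᵢ(x) - ∇fᵢ(x̃)] / (n pᵢ) + ∇̃`, where `full = ∇̃ = (1/n) ∑ⱼ ∇fⱼ(x̃)`. -/
def estimator (snap full x : Vec d) (i : Fin n) : Vec d :=
  (1 / ((n : ℝ) * (p.P i).toReal)) • (gradient (f i) x - gradient (f i) snap) + full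

/-- The proximal update
`argmin_y { ⟨v, y - y'⟩ + (ω / (2η)) ‖y - y'‖² + g(y) }` from the point `y'`. -/
def proxUpdate (v y' : Vec d) : Vec d :=
  argmin fun y => inner ℝ v (y - y') + p.ω / (2 * p.η) * ‖y - y'‖ ^ 2 + g y

/-- One stochastic update: two component gradients, at the current point and at the snapshot. -/
def innerStep (snap full : Vec d) (s : InnerState d) : PMF (InnerState d) :=
  p.P.bind fun i =>
    let y := proxUpdate g p (estimator f p snap full s.x i) s.y
    let x := snap + p.ω • (y - snap)
    PMF.pure ⟨x, y, s.xSum + x, s.calls + 2⟩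

/-- One epoch: `n` component gradients for the full gradient at the snapshot, then `len`
stochastic updates; the new snapshot is the average of their iterates, and the next epoch starts
at `x = (1 - ω) x̃ + ω y`, with `y` kept (Option II). -/
def epoch (s : OuterState d) : PMF (OuterState d) :=
  let full : Vec d := (1 / (n : ℝ)) • ∑ i, gradient (f i) s.snap
  (iterLaw (innerStep f g p s.snap full) s.len ⟨s.x, s.y, 0, s.calls + n⟩).bind fun r =>
    let snap : Vec d := (1 / (s.len : ℝ)) • r.xSum
    PMF.pure ⟨snap, (1 - p.ω) • snap + p.ω • r.y, r.y, s.snapSum + snap,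
      min ⌊p.ρ * (s.len : ℝ)⌋₊ p.m, r.calls⟩

/-- `S` epochs of ASVRG (Option II) from `z.1`, returning the average of the `S` snapshots, which
is the starting point of the next restart. The second component counts component gradients. -/
def asvrgRound (z : Vec d × ℕ) : PMF (Vec d × ℕ) :=
  (iterLaw (epoch f g p) p.S ⟨z.1, z.1, z.1, 0, p.m₁, z.2⟩).bind fun s =>
    PMF.pure ((1 / (p.S : ℝ)) • s.snapSum, s.calls)

/-- ASVRG with restarts every `S` epochs, stopped after two rounds. -/
def asvrg (z : Vec d × ℕ) : PMF (Vec d × ℕ) :=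
  iterLaw (asvrgRound f g p) 2 z

end Algorithm

/-- Step size for epoch length `m`, smoothness `L` and strong convexity `μ`. -/
def stepSize (m : ℕ) (L μ : ℝ) : ℝ :=
  if (m : ℝ) * μ / L ≤ 3 / 4 then 1 / (3 * L) else 1 / (4 * (m : ℝ) * μ)

/-- Momentum parameter for epoch length `m`, smoothness `L` and strong convexity `μ`. -/
def momentum (m : ℕ) (L μ : ℝ) : ℝ :=
  if (m : ℝ) * μ / L ≤ 3 / 4 then Real.sqrt ((m : ℝ) * μ / (3 * L)) else 1 / 2

/-- The parameters of ASVRG for `L`-smooth components and a `μ`-strongly convex regularizer: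
uniform sampling, constant epoch length `m`, and restarts every
`⌈2 ((1 - ω)/ω + ω/(η m μ))⌉` epochs. -/
def params (n m : ℕ) [NeZero n] (L μ : ℝ) : Params n where
  S := ⌈2 * ((1 - momentum m L μ) / momentum m L μ
    + momentum m L μ / (stepSize m L μ * (m : ℝ) * μ))⌉₊
  m := m
  m₁ := m
  ρ := 1
  η := stepSize m L μ
  ω := momentum m L μ
  P := PMF.uniformOfFintype (Fin n)

/-- Joint adaptive regularization and smoothing with ASVRG: the law of the pair (output after `t`
stages, number of component gradients evaluated). In stage `t`, ASVRG is applied, from the output of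
the previous stage, to `(1/n) ∑ᵢ fᵢ^{δₜ}(x) + [g(x) + (σₜ/2)‖x - x₀‖²]` with
`δₜ = 2^t δ₀` and `σₜ = 2^{-t} σ₀`. -/
def adaptRegSmooth {d n : ℕ} [NeZero n] (f : Fin n → Vec d → ℝ) (g : Vec d → ℝ) (m : ℕ)
    (δ₀ σ₀ : ℝ) (x₀ : Vec d) : ℕ → PMF (Vec d × ℕ)
  | 0 => PMF.pure (x₀, 0)
  | t + 1 => (adaptRegSmooth f g m δ₀ σ₀ x₀ t).bind
      (asvrg (fun i => moreau (2 ^ t * δ₀) (f i))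
        (fun x => g x + σ₀ / 2 ^ t / 2 * ‖x - x₀‖ ^ 2)
        (params n m (2 ^ t * δ₀) (σ₀ / 2 ^ t)))

end ASVRG

end

/-! Write `F_t` for the stage objective, `z_t` for its minimizer and `R = ‖x₀ - xs‖`.

One stochastic step: the prox inequality, smoothness and Young's inequality leave a variance term,
which the co-coercive slack of the components at the snapshot absorbs (`avg_step_le`). Over an epoch
this bounds the new snapshot by the `ω`-weighted mean of `F_t(z_t)` and the old snapshot, with a
telescoping distance `‖z_t - y‖²`. Over a round the distances telescope, strong convexity bounds the
first one by the initial gap, and `S` is just large enough to halve the expected gap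
(`meanLE_asvrgRound`). Two rounds quarter it.

The parameters `δ_t`, `σ_t` make the smoothing bias and the regularization at `xs` both equal to
`Δ/2^(t+1)`. Hence stage `t` can keep an entering gap at most `4Δ/2^t`: it leaves with `Δ/2^t`, and
replacing `F_t` by `F_(t+1)` costs another `Δ/2^t`, which gives `4Δ/2^(t+1)`. The final gap in `F`
has the same form (`meanLE_adaptRegSmooth`), and `T` stages bring it below `ε`.

For the cost, `S` is a constant plus a multiple of `√(δ_t/(m σ_t)) = 2^t G R/(Δ √m)`. Summed over
`t` this is geometric, of order `G R/(ε √m)`, and each epoch costs `n + 2m`, of order `n`. -/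

namespace ASVRG

/-! ### Strongly convex minimization -/

section ConvexAnalysis

variable {E : Type*} [NormedAddCommGroup E] [InnerProductSpace ℝ E]

lemma convexOn_quadratic {c : ℝ} (hc : 0 ≤ c) (a : E) :
    ConvexOn ℝ Set.univ fun y : E => c * ‖y - a‖ ^ 2 := by
  have h : ConvexOn ℝ Set.univ fun y : E => ‖y - a‖ := by
    simpa [Function.comp_def, sub_eq_add_neg, dist_eq_norm] using convexOn_univ_dist a
  exact (h.pow (fun _ _ => norm_nonneg _) 2).smul hc

lemma convexOn_inner_sub (v a : E) :
    ConvexOn ℝ Set.univ fun y : E => inner ℝ v (y - a) := by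
  refine ⟨convex_univ, fun x _ y _ s t _ _ hst => le_of_eq ?_⟩
  simp only [inner_sub_right, inner_add_right, inner_smul_right, smul_eq_mul]
  linear_combination inner ℝ v a * hst

/-- Convexity along rays from `a` limits the decrease of `ψ` to linear growth, with slope given by
its minimum `M` on the unit ball, so the quadratic dominates far from `a`. -/
lemma exists_forall_add_quadratic_le [FiniteDimensional ℝ E] {ψ : E → ℝ}
    (hψ : ConvexOn ℝ Set.univ ψ) {c : ℝ} (hc : 0 < c) (a : E) :
    ∃ y, ∀ z, ψ y + c * ‖y - a‖ ^ 2 ≤ ψ z + c * ‖z - a‖ ^ 2 := by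
  have hcont : Continuous ψ := hψ.locallyLipschitz.continuous
  obtain ⟨M, hM⟩ : ∃ M, ∀ u ∈ Metric.closedBall a 1, M ≤ ψ u := by
    obtain ⟨u, -, hu⟩ := (isCompact_closedBall a (1 : ℝ)).exists_isMinOn
      (Metric.nonempty_closedBall.2 zero_le_one) hcont.continuousOn
    exact ⟨ψ u, fun w hw => hu hw⟩
  refine Continuous.exists_forall_le' (by fun_prop : Continuous fun y => ψ y + c * ‖y - a‖ ^ 2)
    a ?_
  have hev : ∀ᶠ x in Filter.cocompact E, x ∉ Metric.closedBall a (1 + (ψ a - M) / c) :=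
    (isCompact_closedBall a _).compl_mem_cocompact
  have hMa : M ≤ ψ a := hM a (Metric.mem_closedBall_self zero_le_one)
  filter_upwards [hev] with x hx
  have hx : 1 + (ψ a - M) / c < ‖x - a‖ := by simpa [dist_eq_norm] using hx
  have hq : 0 ≤ (ψ a - M) / c := div_nonneg (by linarith) hc.le
  set r := ‖x - a‖ with hr
  have hr0 : 0 < r := by linarith
  have hu : (1 - r⁻¹) • a + r⁻¹ • x = a + r⁻¹ • (x - a) := by module
  have h1 := hψ.2 (Set.mem_univ a) (Set.mem_univ x)
    (sub_nonneg.2 (inv_le_one_of_one_le₀ (by linarith))) (inv_nonneg.2 hr0.le)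
    (by ring : (1 - r⁻¹) + r⁻¹ = 1)
  have h2 : M ≤ ψ (a + r⁻¹ • (x - a)) := hM _ (by
    simp only [Metric.mem_closedBall, dist_eq_norm, add_sub_cancel_left, norm_smul, norm_inv,
      Real.norm_eq_abs, abs_of_pos hr0]
    exact (inv_mul_cancel₀ hr0.ne').le)
  rw [hu, smul_eq_mul, smul_eq_mul] at h1
  have h3 : r * M ≤ (r - 1) * ψ a + ψ x := by
    have := mul_le_mul_of_nonneg_left (h2.trans h1) hr0.le
    have e : r * ((1 - r⁻¹) * ψ a + r⁻¹ * ψ x) = (r - 1) * ψ a + ψ x := by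
      field_simp
    linarith
  have h4 : ψ a - M ≤ c * r := by
    have : (ψ a - M) / c ≤ r := by linarith
    rwa [div_le_iff₀' hc] at this
  simp only [sub_self, norm_zero, ne_eq, OfNat.ofNat_ne_zero, not_false_eq_true, zero_pow,
    mul_zero, add_zero]
  nlinarith [mul_le_mul_of_nonneg_left h4 hr0.le]

/-- Compare `y` with `(1 - θ) y + θ z`, divide by `θ`, and let `θ → 0`. -/
lemma add_quadratic_le_of_forall_le {ψ : E → ℝ} (hψ : ConvexOn ℝ Set.univ ψ) {c : ℝ}
    {a y : E} (hy : ∀ z, ψ y + c * ‖y - a‖ ^ 2 ≤ ψ z + c * ‖z - a‖ ^ 2) (z : E) :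
    ψ y + c * ‖y - a‖ ^ 2 + c * ‖z - y‖ ^ 2 ≤ ψ z + c * ‖z - a‖ ^ 2 := by
  have key : ∀ θ : ℝ, 0 < θ → θ < 1 →
      ψ y + c * ‖y - a‖ ^ 2 + (1 - θ) * (c * ‖z - y‖ ^ 2) ≤ ψ z + c * ‖z - a‖ ^ 2 := by
    intro θ h0 h1
    have hconv := hψ.2 (Set.mem_univ y) (Set.mem_univ z) (sub_nonneg.2 h1.le) h0.le
      (by ring : (1 - θ) + θ = 1)
    have hmin := hy ((1 - θ) • y + θ • z)
    have hquad : ‖(1 - θ) • y + θ • z - a‖ ^ 2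
        = (1 - θ) * ‖y - a‖ ^ 2 + θ * ‖z - a‖ ^ 2 - θ * (1 - θ) * ‖z - y‖ ^ 2 := by
      have e1 : (1 - θ) • y + θ • z - a = (1 - θ) • (y - a) + θ • (z - a) := by module
      have e2 : z - y = (z - a) - (y - a) := by abel
      rw [e1, e2, norm_add_sq_real, norm_sub_sq_real (z - a)]
      simp only [norm_smul, inner_smul_left, inner_smul_right, Real.norm_eq_abs, mul_pow, sq_abs,
        conj_trivial]
      rw [real_inner_comm (z - a) (y - a)]
      ring
    rw [hquad] at hmin
    simp only [smul_eq_mul] at hconv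
    refine le_of_mul_le_mul_left ?_ h0
    nlinarith
  have hlim : Filter.Tendsto (fun θ : ℝ => ψ y + c * ‖y - a‖ ^ 2 + (1 - θ) * (c * ‖z - y‖ ^ 2))
      (nhdsWithin 0 (Set.Ioi 0)) (nhds (ψ y + c * ‖y - a‖ ^ 2 + (1 - 0) * (c * ‖z - y‖ ^ 2))) :=
    ((by fun_prop : Continuous fun θ : ℝ =>
      ψ y + c * ‖y - a‖ ^ 2 + (1 - θ) * (c * ‖z - y‖ ^ 2)).tendsto 0).mono_left nhdsWithin_le_nhds
  have := le_of_tendsto hlim (by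
    filter_upwards [Ioo_mem_nhdsGT (zero_lt_one' ℝ)] with θ hθ using key θ hθ.1 hθ.2)
  simpa using this

lemma convexOn_of_subgradient {φ : E → ℝ} {s : E → E}
    (h : ∀ x y, φ x + inner ℝ (s x) (y - x) ≤ φ y) : ConvexOn ℝ Set.univ φ := by
  refine ⟨convex_univ, fun x _ y _ p q hp hq hpq => ?_⟩
  set w := p • x + q • y
  have h1 := mul_le_mul_of_nonneg_left (h w x) hp
  have h2 := mul_le_mul_of_nonneg_left (h w y) hq
  have h3 : p * inner ℝ (s w) (x - w) + q * inner ℝ (s w) (y - w) = 0 := by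
    rw [← inner_smul_right, ← inner_smul_right, ← inner_add_right]
    have : p • (x - w) + q • (y - w) = 0 := by
      have : p • (x - w) + q • (y - w) = (p • x + q • y) - (p + q) • w := by module
      rw [this, hpq, one_smul, sub_self]
    rw [this, inner_zero_right]
  have h4 : φ w = p * φ w + q * φ w := by rw [← add_mul, hpq, one_mul]
  simp only [smul_eq_mul]
  linarith

end ConvexAnalysis

lemma argmin_le {d : ℕ} {h : Vec d → ℝ} (hex : ∃ y, ∀ z, h y ≤ h z) (z : Vec d) :
    h (argmin h) ≤ h z :=
  Classical.epsilon_spec (p := fun y => ∀ z, h y ≤ h z) hex z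

/-- `h` is convex and `L`-smooth, in the quantitative form used by variance reduction: its
gradient gives a quadratic upper bound and a co-coercive lower bound. -/
structure SmoothConvex {d : ℕ} (L : ℝ) (h : Vec d → ℝ) : Prop where
  le_quadratic : ∀ x y, h y ≤ h x + inner ℝ (gradient h x) (y - x) + L / 2 * ‖y - x‖ ^ 2
  cocoercive : ∀ x y, h x + inner ℝ (gradient h x) (y - x)
    + 1 / (2 * L) * ‖gradient h y - gradient h x‖ ^ 2 ≤ h y

/-! ### Moreau envelopes: bias and smoothness -/

section Moreau

variable {d : ℕ} {h : Vec d → ℝ} {G δ : ℝ}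

lemma le_add_quadratic_of_lipschitz (hG : ∀ x y, |h x - h y| ≤ G * ‖x - y‖) (hδ : 0 < δ)
    (x y : Vec d) : h x - G ^ 2 / (2 * δ) ≤ h y + δ / 2 * ‖x - y‖ ^ 2 := by
  have h1 := (le_abs_self _).trans (hG x y)
  have h2 : G ^ 2 / (2 * δ) = δ / 2 * (G / δ) ^ 2 := by field_simp
  have h3 : G * ‖x - y‖ = δ * ((G / δ) * ‖x - y‖) := by field_simp
  have h4 := mul_nonneg hδ.le (sq_nonneg (G / δ - ‖x - y‖))
  rw [h2]
  nlinarith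

/-- Needed because a real `⨅` over a family unbounded below defaults to `0`. -/
lemma bddBelow_moreau (hG : ∀ x y, |h x - h y| ≤ G * ‖x - y‖) (hδ : 0 < δ) (x : Vec d) :
    BddBelow (Set.range fun y : Vec d => h y + δ / 2 * ‖x - y‖ ^ 2) :=
  ⟨_, by rintro _ ⟨y, rfl⟩; exact le_add_quadratic_of_lipschitz hG hδ x y⟩

lemma moreau_le_add (hG : ∀ x y, |h x - h y| ≤ G * ‖x - y‖) (hδ : 0 < δ) (x y : Vec d) :
    moreau δ h x ≤ h y + δ / 2 * ‖x - y‖ ^ 2 :=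
  ciInf_le (bddBelow_moreau hG hδ x) y

lemma moreau_le (hG : ∀ x y, |h x - h y| ≤ G * ‖x - y‖) (hδ : 0 < δ) (x : Vec d) :
    moreau δ h x ≤ h x := by
  simpa using moreau_le_add hG hδ x x

lemma sub_le_moreau (hG : ∀ x y, |h x - h y| ≤ G * ‖x - y‖) (hδ : 0 < δ) (x : Vec d) :
    h x - G ^ 2 / (2 * δ) ≤ moreau δ h x :=
  le_ciInf fun y => le_add_quadratic_of_lipschitz hG hδ x y

lemma moreau_mono (hG : ∀ x y, |h x - h y| ≤ G * ‖x - y‖) (hδ : 0 < δ) {δ' : ℝ} (hδ' : δ ≤ δ')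
    (x : Vec d) : moreau δ h x ≤ moreau δ' h x :=
  ciInf_mono (bddBelow_moreau hG hδ x) fun y => by gcongr

/-- With `p x` the proximal point, the gradient is `δ (x - p x)`. Testing the infimum at `y` with `p
x` gives the upper bound. Quadratic growth of the prox problem at `x`, evaluated at `p y`, gives the
co-coercive bound. Together they make the remainder `O(‖y - x‖²)`, which proves differentiability.
-/
lemma smoothConvex_moreau (hh : ConvexOn ℝ Set.univ h)
    (hG : ∀ x y, |h x - h y| ≤ G * ‖x - y‖) (hδ : 0 < δ) : SmoothConvex δ (moreau δ h) := by
  have hex : ∀ x : Vec d, ∃ p, ∀ y, h p + δ / 2 * ‖p - x‖ ^ 2 ≤ h y + δ / 2 * ‖y - x‖ ^ 2 :=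
    fun x => exists_forall_add_quadratic_le hh (half_pos hδ) x
  choose p hp using hex
  have hval : ∀ x, moreau δ h x = h (p x) + δ / 2 * ‖x - p x‖ ^ 2 := fun x =>
    le_antisymm (moreau_le_add hG hδ x (p x))
      (le_ciInf fun y => by simpa only [norm_sub_rev x] using hp x y)
  have hup : ∀ x y, moreau δ h y
      ≤ moreau δ h x + inner ℝ (δ • (x - p x)) (y - x) + δ / 2 * ‖y - x‖ ^ 2 := by
    intro x y
    have h1 := moreau_le_add hG hδ y (p x)
    have h2 : y - p x = (x - p x) + (y - x) := by abel
    rw [h2, norm_add_sq_real] at h1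
    rw [hval x, real_inner_smul_left]
    linarith
  have hlow : ∀ x y, moreau δ h x + inner ℝ (δ • (x - p x)) (y - x)
      + 1 / (2 * δ) * ‖δ • (y - p y) - δ • (x - p x)‖ ^ 2 ≤ moreau δ h y := by
    intro x y
    have h1 := add_quadratic_le_of_forall_le hh (hp x) (p y)
    rw [hval x, hval y]
    have e1 : p y - x = (y - x) - (y - p y) := by abel
    have e2 : p y - p x = (y - x) - ((y - p y) - (x - p x)) := by abel
    rw [norm_sub_rev (p x) x, e1, e2, norm_sub_sq_real (y - x), norm_sub_sq_real (y - x),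
      inner_sub_right (y - x)] at h1
    rw [← smul_sub δ (y - p y), norm_smul, Real.norm_eq_abs, mul_pow, sq_abs, real_inner_smul_left,
      real_inner_comm (y - x) (x - p x)]
    have e3 : 1 / (2 * δ) * (δ ^ 2 * ‖y - p y - (x - p x)‖ ^ 2)
        = δ / 2 * ‖y - p y - (x - p x)‖ ^ 2 := by field_simp
    rw [e3]
    linarith
  have hgrad : ∀ x, gradient (moreau δ h) x = δ • (x - p x) := by
    intro x
    refine HasGradientAt.gradient (hasGradientAt_iff_isLittleO.2 ?_)
    have hO : (fun y => moreau δ h y - moreau δ h x - inner ℝ (δ • (x - p x)) (y - x))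
        =O[nhds x] fun y => ‖y - x‖ ^ 2 := by
      refine Asymptotics.IsBigO.of_bound (δ / 2) (Filter.Eventually.of_forall fun y => ?_)
      have h1 := hup x y
      have h2 := hlow x y
      have h3 : 0 ≤ 1 / (2 * δ) * ‖δ • (y - p y) - δ • (x - p x)‖ ^ 2 := by positivity
      rw [Real.norm_eq_abs, abs_of_nonneg (by linarith), Real.norm_eq_abs, abs_of_nonneg
        (by positivity)]
      linarith
    refine hO.trans_isLittleO ?_
    have := (Asymptotics.isLittleO_norm_pow_id (E' := Vec d) one_lt_two).comp_tendsto
      (show Filter.Tendsto (fun y : Vec d => y - x) (nhds x) (nhds 0) by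
        simpa using (continuous_sub_right x).tendsto x)
    simpa [Function.comp_def] using this
  exact ⟨fun x y => by rw [hgrad]; exact hup x y, fun x y => by rw [hgrad, hgrad]; exact hlow x y⟩

end Moreau

/-- The finitely supported law `p` satisfies `I` surely, and the mean of `V` is at most `c`. -/
def MeanLE {α : Type*} (p : PMF α) (I : α → Prop) (V : α → ℝ) (c : ℝ) : Prop :=
  p.support.Finite ∧ (∀ a ∈ p.support, I a) ∧ ∑' a, (p a).toReal * V a ≤ c

/-! ### Mean bounds for finitely supported laws -/

section MeanLE

variable {α β : Type*}

lemma summable_toReal_mul {p : PMF α} (hp : p.support.Finite) (V : α → ℝ) :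
    Summable fun a => (p a).toReal * V a :=
  summable_of_hasFiniteSupport (hp.subset fun a ha => by
    rw [PMF.mem_support_iff]; rintro h0; simp [h0] at ha)

lemma tsum_toReal (p : PMF α) : ∑' a, (p a).toReal = 1 := by
  rw [← ENNReal.tsum_toReal_eq fun a => p.apply_ne_top a, p.tsum_coe, ENNReal.toReal_one]

lemma MeanLE.imp {p : PMF α} {I J : α → Prop} {V W : α → ℝ} {c : ℝ} (h : MeanLE p I V c)
    (hIJ : ∀ a, I a → J a) (hVW : ∀ a, I a → W a ≤ V a) : MeanLE p J W c := by
  refine ⟨h.1, fun a ha => hIJ a (h.2.1 a ha), le_trans ?_ h.2.2⟩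
  refine (summable_toReal_mul h.1 W).tsum_le_tsum (fun a => ?_) (summable_toReal_mul h.1 V)
  by_cases ha : a ∈ p.support
  · exact mul_le_mul_of_nonneg_left (hVW a (h.2.1 a ha)) ENNReal.toReal_nonneg
  · simp [(PMF.apply_eq_zero_iff p a).2 ha]

lemma MeanLE.mono {p : PMF α} {I : α → Prop} {V : α → ℝ} {c c' : ℝ} (h : MeanLE p I V c)
    (hc : c ≤ c') : MeanLE p I V c' :=
  ⟨h.1, h.2.1, h.2.2.trans hc⟩

lemma MeanLE.affine {p : PMF α} {I : α → Prop} {V : α → ℝ} {c : ℝ} (h : MeanLE p I V c)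
    {r : ℝ} (hr : 0 ≤ r) (e : ℝ) : MeanLE p I (fun a => r * V a + e) (r * c + e) := by
  refine ⟨h.1, h.2.1, ?_⟩
  have h1 : ∀ a, (p a).toReal * (r * V a + e) = r * ((p a).toReal * V a) + (p a).toReal * e :=
    fun a => by ring
  simp_rw [h1]
  rw [((summable_toReal_mul h.1 V).mul_left r).tsum_add (summable_toReal_mul h.1 fun _ => e),
    tsum_mul_left, tsum_mul_right, tsum_toReal, one_mul]
  exact add_le_add_left (mul_le_mul_of_nonneg_left h.2.2 hr) e

lemma meanLE_pure {I : α → Prop} {V : α → ℝ} {c : ℝ} {a : α} (hI : I a) (hV : V a ≤ c) :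
    MeanLE (PMF.pure a) I V c := by
  classical
  refine ⟨by simp, by simpa using hI, ?_⟩
  rw [tsum_eq_single a fun b hb => by simp [PMF.pure_apply, hb]]
  simpa [PMF.pure_apply] using hV

lemma tsum_bind {p : PMF α} {k : α → PMF β} (hp : p.support.Finite)
    (hk : ∀ a ∈ p.support, (k a).support.Finite) (V : β → ℝ) :
    ∑' b, ((p.bind k) b).toReal * V b = ∑' a, (p a).toReal * ∑' b, (k a b).toReal * V b := by
  have h1 : ∀ b, ((p.bind k) b).toReal * V b
      = ∑ a ∈ hp.toFinset, (p a).toReal * ((k a b).toReal * V b) := by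
    intro b
    rw [PMF.bind_apply, tsum_eq_sum (s := hp.toFinset) fun a ha => by
        rw [(PMF.apply_eq_zero_iff p a).2 (by simpa using ha), zero_mul],
      ENNReal.toReal_sum fun a _ => ENNReal.mul_ne_top (p.apply_ne_top a) ((k a).apply_ne_top b),
      Finset.sum_mul]
    simp only [ENNReal.toReal_mul, mul_assoc]
  simp_rw [h1]
  rw [Summable.tsum_finsetSum fun a ha =>
      (summable_toReal_mul (hk a (by simpa using ha)) V).mul_left _,
    tsum_eq_sum (s := hp.toFinset) fun a ha => by
      rw [(PMF.apply_eq_zero_iff p a).2 (by simpa using ha), ENNReal.toReal_zero, zero_mul]]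
  simp only [tsum_mul_left]

/-- The tower property: the potential of the current state serves as the conditional bound on the
next one. -/
lemma MeanLE.bind {p : PMF α} {k : α → PMF β} {I : α → Prop} {J : β → Prop} {V : α → ℝ}
    {W : β → ℝ} {c : ℝ} (h : MeanLE p I V c) (hk : ∀ a, I a → MeanLE (k a) J W (V a)) :
    MeanLE (p.bind k) J W c := by
  have hk' : ∀ a ∈ p.support, MeanLE (k a) J W (V a) := fun a ha => hk a (h.2.1 a ha)
  refine ⟨?_, fun b hb => ?_, ?_⟩
  · rw [PMF.support_bind]
    exact h.1.biUnion fun a ha => (hk' a ha).1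
  · obtain ⟨a, ha, hb⟩ := (PMF.mem_support_bind_iff p k b).1 hb
    exact (hk' a ha).2.1 b hb
  · rw [tsum_bind h.1 fun a ha => (hk' a ha).1]
    exact (MeanLE.imp (J := fun _ => True) (W := fun a => ∑' b, (k a b).toReal * W b) h
      (fun _ _ => trivial) fun a ha => (hk a ha).2.2).2.2

lemma meanLE_uniform {n : ℕ} [NeZero n] {I : Fin n → Prop} {V : Fin n → ℝ} {c : ℝ}
    (hI : ∀ i, I i) (hV : 1 / (n : ℝ) * ∑ i, V i ≤ c) :
    MeanLE (PMF.uniformOfFintype (Fin n)) I V c := by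
  refine ⟨Set.toFinite _, fun i _ => hI i, ?_⟩
  simpa [tsum_fintype, PMF.uniformOfFintype_apply, Finset.mul_sum] using hV

/-- A supermartingale principle, with a time-dependent sure invariant `I` and potential `V`. -/
lemma meanLE_iterLaw {α : Type} {step : α → PMF α} {I : ℕ → α → Prop} {V : ℕ → α → ℝ} {s : α}
    (hs : I 0 s) (hstep : ∀ k a, I k a → MeanLE (step a) (I (k + 1)) (V (k + 1)) (V k a)) (k : ℕ) :
    MeanLE (iterLaw step k s) (I k) (V k) (V 0 s) := by
  induction k with
  | zero => exact meanLE_pure hs le_rfl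
  | succ k ih => exact ih.bind (hstep k)

open MeasureTheory in
lemma MeanLE.integrable [MeasurableSpace α] [MeasurableSingletonClass α] {p : PMF α}
    {I : α → Prop} {V : α → ℝ} {c : ℝ} (h : MeanLE p I V c) (W : α → ℝ) :
    Integrable W p.toMeasure := by
  have : IntegrableOn W (h.1.toFinset : Set α) p.toMeasure := IntegrableOn.finset
  rwa [h.1.coe_toFinset, IntegrableOn, PMF.restrict_toMeasure_support] at this

open MeasureTheory in
lemma MeanLE.integral_le [MeasurableSpace α] [MeasurableSingletonClass α] {p : PMF α}
    {I : α → Prop} {V : α → ℝ} {c : ℝ} (h : MeanLE p I V c) :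
    ∫ a, V a ∂p.toMeasure ≤ c := by
  rw [PMF.integral_eq_tsum p V (h.integrable V)]
  exact h.2.2

end MeanLE

/-! ### One stochastic update -/

section OneStep

variable {d n : ℕ}

lemma convexOn_avg {f : Fin n → Vec d → ℝ} (hf : ∀ i, ConvexOn ℝ Set.univ (f i)) :
    ConvexOn ℝ Set.univ fun x => (1 / (n : ℝ)) * ∑ i, f i x := by
  have h : ConvexOn ℝ Set.univ fun x => ∑ i, f i x := by
    refine ⟨convex_univ, fun x _ y _ p q hp hq hpq => ?_⟩
    simp only [Finset.smul_sum]
    rw [← Finset.sum_add_distrib]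
    exact Finset.sum_le_sum fun i _ => (hf i).2 (Set.mem_univ x) (Set.mem_univ y) hp hq hpq
  exact h.smul (by positivity)

lemma SmoothConvex.convexOn {L : ℝ} (hL : 0 < L) {h : Vec d → ℝ} (hh : SmoothConvex L h) :
    ConvexOn ℝ Set.univ h :=
  convexOn_of_subgradient fun x y => le_trans (le_add_of_nonneg_right (by positivity))
    (hh.cocoercive x y)

lemma convexOn_objective {L : ℝ} (hL : 0 < L) {h : Fin n → Vec d → ℝ} {ψ : Vec d → ℝ}
    (hh : ∀ i, SmoothConvex L (h i)) (hψ : ConvexOn ℝ Set.univ ψ) :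
    ConvexOn ℝ Set.univ (objective h ψ) :=
  (convexOn_avg fun i => (hh i).convexOn hL).add hψ

lemma sum_norm_sub_mean_sq_le [NeZero n] (w : Fin n → Vec d) :
    ∑ i, ‖w i - (1 / (n : ℝ)) • ∑ j, w j‖ ^ 2 ≤ ∑ i, ‖w i‖ ^ 2 := by
  have hn : (n : ℝ) ≠ 0 := Nat.cast_ne_zero.2 (NeZero.ne n)
  set a := (1 / (n : ℝ)) • ∑ j, w j with ha
  have h1 : ∑ i, inner ℝ (w i) a = n * ‖a‖ ^ 2 := by
    have : ∑ j, w j = (n : ℝ) • a := by rw [ha, smul_smul, mul_one_div_cancel hn, one_smul]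
    rw [← sum_inner, this, real_inner_smul_left, real_inner_self_eq_norm_sq]
  simp_rw [norm_sub_sq_real]
  rw [Finset.sum_add_distrib, Finset.sum_sub_distrib, ← Finset.mul_sum, h1]
  simp only [Finset.sum_const, Finset.card_univ, Fintype.card_fin, nsmul_eq_mul]
  have : 0 ≤ (n : ℝ) * ‖a‖ ^ 2 := by positivity
  linarith

lemma avg_le_of_forall_le {u w : Fin n → ℝ} (huw : ∀ i, u i ≤ w i) :
    1 / (n : ℝ) * ∑ i, u i ≤ 1 / (n : ℝ) * ∑ i, w i :=
  mul_le_mul_of_nonneg_left (Finset.sum_le_sum fun i _ => huw i) (by positivity)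

/-- Strong convexity makes the minimum exist, so the `argmin` chosen by `epsilon` is genuine and has
quadratic growth. -/
lemma proxUpdate_le (p : Params n) (hc : 0 < p.ω / (2 * p.η)) {ψ : Vec d → ℝ}
    (hψ : ConvexOn ℝ Set.univ ψ) (v y' z : Vec d) :
    inner ℝ v (proxUpdate ψ p v y' - y') + ψ (proxUpdate ψ p v y')
      + p.ω / (2 * p.η) * ‖proxUpdate ψ p v y' - y'‖ ^ 2
      + p.ω / (2 * p.η) * ‖z - proxUpdate ψ p v y'‖ ^ 2
      ≤ inner ℝ v (z - y') + ψ z + p.ω / (2 * p.η) * ‖z - y'‖ ^ 2 := by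
  have hconv : ConvexOn ℝ Set.univ fun y => inner ℝ v (y - y') + ψ y :=
    (convexOn_inner_sub v y').add hψ
  refine add_quadratic_le_of_forall_le hconv (fun u => ?_) z
  obtain ⟨y, hy⟩ := exists_forall_add_quadratic_le hconv hc y'
  have := argmin_le (h := fun y => inner ℝ v (y - y') + p.ω / (2 * p.η) * ‖y - y'‖ ^ 2 + ψ y)
    ⟨y, fun u => by have := hy u; linarith⟩ u
  change inner ℝ v (proxUpdate ψ p v y' - y') + p.ω / (2 * p.η) * ‖proxUpdate ψ p v y' - y'‖ ^ 2
    + ψ (proxUpdate ψ p v y') ≤ _ at this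
  linarith

/-- Hypotheses on the parameters and the component functions under which ASVRG converges. -/
structure Admissible [NeZero n] (p : Params n) (L : ℝ) (h : Fin n → Vec d → ℝ)
    (ψ : Vec d → ℝ) : Prop where
  L_pos : 0 < L
  η_pos : 0 < p.η
  ω_pos : 0 < p.ω
  ω_le : p.ω ≤ 1 / 2
  η_le : 3 * L * p.η ≤ 1
  P_eq : p.P = PMF.uniformOfFintype (Fin n)
  smooth : ∀ i, SmoothConvex L (h i)
  convex : ConvexOn ℝ Set.univ ψ

variable [NeZero n] {p : Params n} {L : ℝ} {h : Fin n → Vec d → ℝ} {ψ : Vec d → ℝ}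

lemma momentum_step_le (H : Admissible p L h ψ) (φ : Vec d → ℝ) (D v x y' snap z : Vec d)
    (hφ : ∀ y, φ y ≤ φ x + inner ℝ D (y - x) + L / 2 * ‖y - x‖ ^ 2)
    (hx : x = snap + p.ω • (y' - snap)) {y x' : Vec d} (hy : y = proxUpdate ψ p v y')
    (hx' : x' = snap + p.ω • (y - snap)) :
    φ x' + ψ x' + p.ω ^ 2 / (2 * p.η) * ‖z - y‖ ^ 2
      ≤ φ x + p.ω * inner ℝ v (z - y') + p.ω * ψ z + (1 - p.ω) * ψ snap
        + p.ω ^ 2 / (2 * p.η) * ‖z - y'‖ ^ 2 + 3 * p.η / 4 * ‖v - D‖ ^ 2 := by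
  have hη := H.η_pos
  have hω := H.ω_pos
  have h1 := mul_le_mul_of_nonneg_left
    (proxUpdate_le p (by positivity) H.convex v y' z) hω.le
  rw [← hy] at h1
  have hd : x' - x = p.ω • (y - y') := by rw [hx, hx']; module
  have h2 := hφ x'
  have h3 : ψ x' ≤ (1 - p.ω) * ψ snap + p.ω * ψ y := by
    have := H.convex.2 (Set.mem_univ snap) (Set.mem_univ y)
      (by linarith [H.ω_le] : 0 ≤ 1 - p.ω) hω.le (by ring)
    have e : (1 - p.ω) • snap + p.ω • y = x' := by rw [hx']; module
    simpa only [e, smul_eq_mul] using this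
  -- The prox term supplies `‖x' - x‖² / (2η)`. One third of it pays for smoothness, as `3Lη ≤ 1`,
  -- and two thirds for Young's inequality on `v - D`.
  have h4 : L / 2 * ‖x' - x‖ ^ 2 ≤ 1 / (6 * p.η) * ‖x' - x‖ ^ 2 := by
    refine mul_le_mul_of_nonneg_right ?_ (sq_nonneg _)
    rw [le_div_iff₀ (by positivity)]
    linarith [H.η_le]
  have h5 : inner ℝ D (x' - x) ≤ inner ℝ v (x' - x) + 3 * p.η / 4 * ‖v - D‖ ^ 2
      + 1 / (3 * p.η) * ‖x' - x‖ ^ 2 := by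
    have h6 : inner ℝ D (x' - x) = inner ℝ v (x' - x) - inner ℝ (v - D) (x' - x) := by
      rw [inner_sub_left]; ring
    have h7 := (neg_le_abs _).trans (abs_real_inner_le_norm (v - D) (x' - x))
    have h8 : ‖v - D‖ * ‖x' - x‖ ≤ 3 * p.η / 4 * ‖v - D‖ ^ 2 + 1 / (3 * p.η) * ‖x' - x‖ ^ 2 := by
      have h9 : 3 * p.η / 4 * ‖v - D‖ ^ 2 + 1 / (3 * p.η) * ‖x' - x‖ ^ 2 - ‖v - D‖ * ‖x' - x‖
          = 1 / (3 * p.η) * (3 * p.η / 2 * ‖v - D‖ - ‖x' - x‖) ^ 2 := by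
        field_simp; ring
      have : 0 ≤ 1 / (3 * p.η) * (3 * p.η / 2 * ‖v - D‖ - ‖x' - x‖) ^ 2 := by positivity
      linarith
    linarith
  have h10 : 1 / (6 * p.η) * ‖x' - x‖ ^ 2 + 1 / (3 * p.η) * ‖x' - x‖ ^ 2
      = p.ω * (p.ω / (2 * p.η) * ‖y - y'‖ ^ 2) := by
    rw [hd, norm_smul, Real.norm_eq_abs, mul_pow, sq_abs]
    field_simp; ring
  have h11 : inner ℝ v (x' - x) = p.ω * inner ℝ v (y - y') := by rw [hd, inner_smul_right]
  have h12 : p.ω ^ 2 / (2 * p.η) = p.ω * (p.ω / (2 * p.η)) := by ring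
  rw [h12]
  linarith

lemma avg_step_le (H : Admissible p L h ψ) (x y' snap z : Vec d)
    (hx : x = snap + p.ω • (y' - snap)) (y x' : Fin n → Vec d)
    (hy : ∀ i, y i = proxUpdate ψ p (estimator h p snap
      ((1 / (n : ℝ)) • ∑ j, gradient (h j) snap) x i) y')
    (hx' : ∀ i, x' i = snap + p.ω • (y i - snap)) :
    1 / (n : ℝ) * ∑ i, (objective h ψ (x' i) + p.ω ^ 2 / (2 * p.η) * ‖z - y i‖ ^ 2)
      ≤ p.ω * objective h ψ z + (1 - p.ω) * objective h ψ snap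
        + p.ω ^ 2 / (2 * p.η) * ‖z - y'‖ ^ 2 := by
  have hn : (n : ℝ) ≠ 0 := Nat.cast_ne_zero.2 (NeZero.ne n)
  have hη := H.η_pos
  have hω := H.ω_pos
  have hL := H.L_pos
  set w : Fin n → Vec d := fun i => gradient (h i) x - gradient (h i) snap with hw
  set D : Vec d := (1 / (n : ℝ)) • ∑ j, gradient (h j) x with hD
  set φ : Vec d → ℝ := fun u => 1 / (n : ℝ) * ∑ i, h i u with hφdef
  set v : Fin n → Vec d := fun i => estimator h p snap
    ((1 / (n : ℝ)) • ∑ j, gradient (h j) snap) x i with hv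
  have hconst : ∀ c : ℝ, 1 / (n : ℝ) * ∑ _i : Fin n, c = c := fun c => by simp [hn]
  have hinner : ∀ u, 1 / (n : ℝ) * ∑ i, inner ℝ (gradient (h i) x) u = inner ℝ D u := fun u => by
    rw [hD, real_inner_smul_left, sum_inner]
  have hvD : ∀ i, v i - D = w i - (1 / (n : ℝ)) • ∑ j, w j := by
    intro i
    have e : 1 / ((n : ℝ) * (p.P i).toReal) = 1 := by
      rw [H.P_eq, PMF.uniformOfFintype_apply]; simp [hn]
    simp only [hv, hD, hw, estimator, e, one_smul, Finset.sum_sub_distrib, smul_sub]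
    abel
  have hvar : 1 / (n : ℝ) * ∑ i, ‖v i - D‖ ^ 2 ≤ 1 / (n : ℝ) * ∑ i, ‖w i‖ ^ 2 := by
    simp_rw [hvD]
    exact mul_le_mul_of_nonneg_left (sum_norm_sub_mean_sq_le w) (by positivity)
  have hmean : ∀ u, 1 / (n : ℝ) * ∑ i, inner ℝ (v i) u = inner ℝ D u := by
    intro u
    have e : ∀ i, inner ℝ (v i) u = inner ℝ D u + inner ℝ (w i) u
        - inner ℝ ((1 / (n : ℝ)) • ∑ j, w j) u := fun i => by
      rw [← inner_add_left, ← inner_sub_left]; congr 1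
      rw [add_sub_assoc, ← hvD]; abel
    simp_rw [e]
    rw [Finset.sum_sub_distrib, Finset.sum_add_distrib, mul_sub, mul_add, hconst, hconst,
      real_inner_smul_left (∑ j, w j), sum_inner]
    ring
  have hquad : ∀ u, φ u ≤ φ x + inner ℝ D (u - x) + L / 2 * ‖u - x‖ ^ 2 := by
    intro u
    have := avg_le_of_forall_le fun i => (H.smooth i).le_quadratic x u
    rwa [Finset.sum_add_distrib, Finset.sum_add_distrib, mul_add, mul_add, hinner, hconst] at this
  have hcoc : φ x + inner ℝ D (snap - x) + 1 / (2 * L) * (1 / (n : ℝ) * ∑ i, ‖w i‖ ^ 2)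
      ≤ φ snap := by
    have := avg_le_of_forall_le fun i => (H.smooth i).cocoercive x snap
    rw [Finset.sum_add_distrib, Finset.sum_add_distrib, mul_add, mul_add, hinner,
      ← Finset.mul_sum] at this
    simp_rw [norm_sub_rev (gradient (h _) snap)] at this
    linarith
  have hsub : φ x + inner ℝ D (z - x) ≤ φ z := by
    have := avg_le_of_forall_le fun i => le_trans
      (le_add_of_nonneg_right (by positivity)) ((H.smooth i).cocoercive x z)
    rwa [Finset.sum_add_distrib, mul_add, hinner] at this
  have hstep := avg_le_of_forall_le fun i => momentum_step_le H φ D (v i) x y' snap z hquad hx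
    (hy i) (hx' i)
  have e1 : 1 / (n : ℝ) * ∑ i, (φ x + p.ω * inner ℝ (v i) (z - y') + p.ω * ψ z
      + (1 - p.ω) * ψ snap + p.ω ^ 2 / (2 * p.η) * ‖z - y'‖ ^ 2 + 3 * p.η / 4 * ‖v i - D‖ ^ 2)
      = φ x + p.ω * inner ℝ D (z - y') + p.ω * ψ z + (1 - p.ω) * ψ snap
        + p.ω ^ 2 / (2 * p.η) * ‖z - y'‖ ^ 2
        + 3 * p.η / 4 * (1 / (n : ℝ) * ∑ i, ‖v i - D‖ ^ 2) := by
    simp only [Finset.sum_add_distrib, mul_add, hconst]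
    simp only [← Finset.mul_sum]
    -- The estimator is unbiased, so on average `v i` may be replaced by `D`.
    rw [← hmean]
    ring
  -- The coupling of `x`, `y'` and `snap` splits the linear term into a comparison with `z` and one
  -- with the snapshot. The latter carries the co-coercive slack.
  have e2 : p.ω * inner ℝ D (z - y') = p.ω * inner ℝ D (z - x)
      + (1 - p.ω) * inner ℝ D (snap - x) := by
    simp only [← inner_smul_right, ← inner_add_right]
    congr 1
    rw [hx]; module
  have hW : 0 ≤ 1 / (n : ℝ) * ∑ i, ‖w i‖ ^ 2 := by positivity
  have e3 : 3 * p.η / 4 * (1 / (n : ℝ) * ∑ i, ‖v i - D‖ ^ 2)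
      ≤ (1 - p.ω) * (1 / (2 * L) * (1 / (n : ℝ) * ∑ i, ‖w i‖ ^ 2)) := by
    refine (mul_le_mul_of_nonneg_left hvar (by positivity)).trans ?_
    rw [← mul_assoc (1 - p.ω)]
    refine mul_le_mul_of_nonneg_right ?_ hW
    -- With `1 - ω ≥ 1/2`, the slack outweighs the variance.
    have h1 : 3 * p.η / 4 ≤ 1 / 2 * (1 / (2 * L)) := by
      rw [← mul_div_assoc, mul_one, div_div, div_le_div_iff₀ (by positivity) (by positivity)]
      linarith [H.η_le]
    refine h1.trans (mul_le_mul_of_nonneg_right (by linarith [H.ω_le]) (by positivity))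
  have e4 := mul_le_mul_of_nonneg_left hcoc (by linarith [H.ω_le] : 0 ≤ 1 - p.ω)
  have e5 := mul_le_mul_of_nonneg_left hsub hω.le
  rw [e1, e2] at hstep
  have e6 : ∀ u, objective h ψ u = φ u + ψ u := fun u => rfl
  simp only [e6]
  linarith

end OneStep

/-! ### Epochs and rounds -/

section Round

variable {d n : ℕ}

/-- Jensen in incremental form, so that a potential can track the running sum alone. At `k = 0` the
first term on the right vanishes, hence the condition on `s`. -/
lemma perspective_add_le {F : Vec d → ℝ} (hF : ConvexOn ℝ Set.univ F) (k : ℕ) (s x : Vec d)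
    (h0 : k = 0 → s = 0) :
    ((k + 1 : ℕ) : ℝ) * F ((1 / ((k + 1 : ℕ) : ℝ)) • (s + x))
      ≤ (k : ℝ) * F ((1 / (k : ℝ)) • s) + F x := by
  rcases Nat.eq_zero_or_pos k with rfl | hk
  · simp [h0 rfl]
  · have hk' : (0 : ℝ) < k := Nat.cast_pos.2 hk
    have h1 := hF.2 (Set.mem_univ ((1 / (k : ℝ)) • s)) (Set.mem_univ x)
      (by positivity : 0 ≤ (k : ℝ) / (k + 1)) (by positivity : 0 ≤ 1 / ((k : ℝ) + 1))
      (by field_simp)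
    have e : ((k : ℝ) / (k + 1)) • (1 / (k : ℝ)) • s + (1 / ((k : ℝ) + 1)) • x
        = (1 / ((k : ℝ) + 1)) • (s + x) := by
      rw [smul_smul, smul_add]; congr 2; field_simp
    rw [e, smul_eq_mul, smul_eq_mul] at h1
    push_cast
    have h2 := mul_le_mul_of_nonneg_left h1 (by positivity : (0 : ℝ) ≤ k + 1)
    refine h2.trans_eq ?_
    field_simp

variable [NeZero n] {p : Params n} {L : ℝ} {h : Fin n → Vec d → ℝ} {ψ : Vec d → ℝ}

lemma meanLE_innerLoop (H : Admissible p L h ψ) (snap z : Vec d) (s : InnerState d)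
    (hx : s.x = snap + p.ω • (s.y - snap)) (hsum : s.xSum = 0) (k : ℕ) :
    MeanLE (iterLaw (innerStep h ψ p snap ((1 / (n : ℝ)) • ∑ j, gradient (h j) snap)) k s)
      (fun r => r.calls = s.calls + 2 * k)
      (fun r => (k : ℝ) * objective h ψ ((1 / (k : ℝ)) • r.xSum)
        + p.ω ^ 2 / (2 * p.η) * ‖z - r.y‖ ^ 2
        - k * (p.ω * objective h ψ z + (1 - p.ω) * objective h ψ snap))
      (p.ω ^ 2 / (2 * p.η) * ‖z - s.y‖ ^ 2) := by
  refine ((meanLE_iterLaw (I := fun k (r : InnerState d) => r.x = snap + p.ω • (r.y - snap)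
      ∧ r.calls = s.calls + 2 * k ∧ (k = 0 → r.xSum = 0))
    (V := fun k (r : InnerState d) => (k : ℝ) * objective h ψ ((1 / (k : ℝ)) • r.xSum)
        + p.ω ^ 2 / (2 * p.η) * ‖z - r.y‖ ^ 2
        - k * (p.ω * objective h ψ z + (1 - p.ω) * objective h ψ snap))
    ⟨hx, rfl, fun _ => hsum⟩ (fun k r hr => ?_) k).imp (fun r hr => hr.2.1)
      fun r _ => le_rfl).mono (by simp)
  unfold innerStep
  rw [H.P_eq]
  refine (meanLE_uniform (I := fun _ => True) (V := fun i => _) (fun _ => trivial) ?_).bind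
    fun i _ => meanLE_pure ⟨rfl, by rw [hr.2.1]; ring, by simp⟩ le_rfl
  have hstep := avg_step_le H r.x r.y snap z hr.1 _ _ (fun _ => rfl) fun _ => rfl
  refine (avg_le_of_forall_le fun i => sub_le_sub_right (add_le_add_left
    (perspective_add_le (convexOn_objective H.L_pos H.smooth H.convex) k r.xSum _ hr.2.2) _)
      _).trans ?_
  simp only [add_assoc, Finset.sum_sub_distrib, Finset.sum_add_distrib, mul_add, mul_sub] at hstep ⊢
  simp only [Finset.sum_const, Finset.card_univ, Fintype.card_fin, nsmul_eq_mul]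
  have hn : (n : ℝ) ≠ 0 := Nat.cast_ne_zero.2 (NeZero.ne n)
  have e : ∀ c : ℝ, 1 / (n : ℝ) * (n * c) = c := fun c => by field_simp
  simp only [e]
  push_cast
  linarith

lemma meanLE_epoch (H : Admissible p L h ψ) (z : Vec d) (s : OuterState d) {m : ℕ} (hm : 0 < m)
    (hlen : s.len = m) (hpm : p.m = m) (hρ : p.ρ = 1)
    (hx : s.x = s.snap + p.ω • (s.y - s.snap)) :
    MeanLE (epoch h ψ p s)
      (fun r => r.len = m ∧ r.x = r.snap + p.ω • (r.y - r.snap)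
        ∧ r.calls = s.calls + (n + 2 * m) ∧ r.snapSum = s.snapSum + r.snap)
      (fun r => objective h ψ r.snap + p.ω ^ 2 / (2 * p.η * m) * ‖z - r.y‖ ^ 2)
      (p.ω * objective h ψ z + (1 - p.ω) * objective h ψ s.snap
        + p.ω ^ 2 / (2 * p.η * m) * ‖z - s.y‖ ^ 2) := by
  have hm' : (0 : ℝ) < m := Nat.cast_pos.2 hm
  have hη := H.η_pos
  unfold epoch
  have h1 := (meanLE_innerLoop H s.snap z ⟨s.x, s.y, 0, s.calls + n⟩ hx rfl s.len).affine
    (r := 1 / (m : ℝ)) (by positivity)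
    (p.ω * objective h ψ z + (1 - p.ω) * objective h ψ s.snap)
  refine (h1.mono (le_of_eq ?_)).bind fun r hr => meanLE_pure ⟨?_, ?_, ?_, rfl⟩ (le_of_eq ?_)
  · field_simp; ring
  · simp [hlen, hpm, hρ]
  · simp only; module
  · simp only at hr ⊢; rw [hr, hlen]; ring
  · simp only [hlen]; field_simp; ring

lemma meanLE_asvrgRound (H : Admissible p L h ψ) {m : ℕ} (hm : 0 < m) (hpm₁ : p.m₁ = m)
    (hpm : p.m = m) (hρ : p.ρ = 1) {μ : ℝ} (hμ : 0 < μ) {z : Vec d}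
    (hz : ∀ x, objective h ψ z + μ / 2 * ‖z - x‖ ^ 2 ≤ objective h ψ x)
    (hS : 2 * ((1 - p.ω) / p.ω + p.ω / (p.η * m * μ)) ≤ p.S) (s : Vec d × ℕ) :
    MeanLE (asvrgRound h ψ p s) (fun r => r.2 = s.2 + p.S * (n + 2 * m))
      (fun r => objective h ψ r.1 - objective h ψ z)
      (1 / 2 * (objective h ψ s.1 - objective h ψ z)) := by
  have hm' : (0 : ℝ) < m := Nat.cast_pos.2 hm
  have hη := H.η_pos
  have hω := H.ω_pos
  have hω1 : 0 < 1 - p.ω := by linarith [H.ω_le]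
  have hSpos : (0 : ℝ) < p.S := lt_of_lt_of_le (by positivity) hS
  have hF := convexOn_objective H.L_pos H.smooth H.convex
  unfold asvrgRound
  -- Each epoch trades `(1 - ω)` times the old snapshot value for one full new value: `(1 - ω)` of
  -- it stays in the potential and `ω` goes to the running average.
  have h1 := meanLE_iterLaw (step := epoch h ψ p) (s := ⟨s.1, s.1, s.1, 0, p.m₁, s.2⟩)
    (I := fun k (r : OuterState d) => r.len = m ∧ r.x = r.snap + p.ω • (r.y - r.snap)
      ∧ r.calls = s.2 + k * (n + 2 * m) ∧ (k = 0 → r.snapSum = 0))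
    (V := fun k (r : OuterState d) => p.ω * ((k : ℝ) * objective h ψ ((1 / (k : ℝ)) • r.snapSum))
      + (1 - p.ω) * objective h ψ r.snap + p.ω ^ 2 / (2 * p.η * m) * ‖z - r.y‖ ^ 2
      - p.ω * k * objective h ψ z)
    ⟨hpm₁, by simp, by simp, fun _ => rfl⟩ (fun k r hr => ?_) p.S
  · have h2 := h1.affine (r := 1 / (p.ω * p.S)) (by positivity)
      (-((1 / (p.ω * p.S)) * ((1 - p.ω) * objective h ψ z)))
    refine (h2.mono ?_).bind fun r hr => meanLE_pure hr.2.2.1 ?_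
    · have h3 := hz s.1
      set γ := objective h ψ s.1 - objective h ψ z with hγ
      -- Strong convexity turns the initial distance into the initial gap.
      have h4 : p.ω ^ 2 / (2 * p.η * m) * ‖z - s.1‖ ^ 2
          ≤ p.ω * (p.ω / (p.η * m * μ)) * γ := by
        have : p.ω ^ 2 / (2 * p.η * m) * ‖z - s.1‖ ^ 2
          = p.ω * (p.ω / (p.η * m * μ)) * (μ / 2 * ‖z - s.1‖ ^ 2) := by field_simp
        rw [this]
        exact mul_le_mul_of_nonneg_left (by linarith) (by positivity)
      have hγ0 : 0 ≤ γ := by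
        have : 0 ≤ μ / 2 * ‖z - s.1‖ ^ 2 := by positivity
        linarith
      have h5 := mul_le_mul_of_nonneg_right hS (mul_nonneg hω.le hγ0)
      have h6 : p.ω * ((1 - p.ω) / p.ω) = 1 - p.ω := by field_simp
      rw [← mul_neg, ← mul_add, one_div (p.ω * (p.S : ℝ)), inv_mul_le_iff₀ (by positivity)]
      simp only [Nat.cast_zero, zero_mul, mul_zero, sub_zero, zero_add]
      have h7 : (1 - p.ω) * objective h ψ s.1
          = (1 - p.ω) * γ + (1 - p.ω) * objective h ψ z := by rw [hγ]; ring
      have h8 : 2 * ((1 - p.ω) / p.ω + p.ω / (p.η * m * μ)) * (p.ω * γ)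
          = 2 * (p.ω * ((1 - p.ω) / p.ω) * γ + p.ω * (p.ω / (p.η * m * μ)) * γ) := by ring
      rw [h8, h6] at h5
      linarith
    · have h3 : objective h ψ z ≤ objective h ψ r.snap := by
        have : 0 ≤ μ / 2 * ‖z - r.snap‖ ^ 2 := by positivity
        linarith [hz r.snap]
      have h4 : 0 ≤ p.ω ^ 2 / (2 * p.η * m) * ‖z - r.y‖ ^ 2 := by positivity
      have h5 := mul_le_mul_of_nonneg_left h3 hω1.le
      rw [← mul_neg, ← mul_add, one_div (p.ω * (p.S : ℝ)), le_inv_mul_iff₀ (by positivity)]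
      linarith
  · have h2 := (meanLE_epoch H z r hm hr.1 hpm hρ hr.2.1).affine zero_le_one
      (p.ω * (k * objective h ψ ((1 / (k : ℝ)) • r.snapSum))
        - p.ω * (k + 1 : ℕ) * objective h ψ z)
    refine (h2.mono ?_).imp (fun q hq => ⟨hq.1, hq.2.1, ?_, by simp⟩) fun q hq => ?_
    · push_cast; linarith
    · rw [hq.2.2.1, hr.2.2.1]; ring
    · have h3 := mul_le_mul_of_nonneg_left
        (perspective_add_le hF k r.snapSum q.snap hr.2.2.2) hω.le
      rw [hq.2.2.2]
      linarith

lemma meanLE_asvrg (H : Admissible p L h ψ) {m : ℕ} (hm : 0 < m) (hpm₁ : p.m₁ = m)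
    (hpm : p.m = m) (hρ : p.ρ = 1) {μ : ℝ} (hμ : 0 < μ) {z : Vec d}
    (hz : ∀ x, objective h ψ z + μ / 2 * ‖z - x‖ ^ 2 ≤ objective h ψ x)
    (hS : 2 * ((1 - p.ω) / p.ω + p.ω / (p.η * m * μ)) ≤ p.S) (s : Vec d × ℕ) :
    MeanLE (asvrg h ψ p s) (fun r => r.2 = s.2 + 2 * (p.S * (n + 2 * m)))
      (fun r => objective h ψ r.1 - objective h ψ z)
      (1 / 4 * (objective h ψ s.1 - objective h ψ z)) := by
  have h1 := meanLE_iterLaw (step := asvrgRound h ψ p) (s := s)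
    (I := fun k (r : Vec d × ℕ) => r.2 = s.2 + k * (p.S * (n + 2 * m)))
    (V := fun k (r : Vec d × ℕ) => 2 ^ k * (objective h ψ r.1 - objective h ψ z))
    (by simp) (fun k r hr => ?_) 2
  · refine ((h1.affine (r := 1 / 4) (by norm_num) 0).mono (by simp)).imp
      (fun r hr => hr) fun r _ => by linarith
  · refine (((meanLE_asvrgRound H hm hpm₁ hpm hρ hμ hz hS r).affine
      (r := 2 ^ (k + 1)) (by positivity) 0).mono (by rw [pow_succ]; linarith)).imp
      (fun q hq => by rw [hq, hr]; ring) fun q _ => by simp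

end Round

/-! ### The parameter choice -/

section Parameters

variable {d n m : ℕ} {L μ : ℝ} {h : Fin n → Vec d → ℝ} {ψ : Vec d → ℝ}

lemma exists_minimizer_objective (hL : 0 < L) (hh : ∀ i, SmoothConvex L (h i)) {g : Vec d → ℝ}
    (hg : ConvexOn ℝ Set.univ g) (hμ : 0 < μ) (x₀ : Vec d) :
    ∃ z, ∀ x, objective h (fun x => g x + μ / 2 * ‖x - x₀‖ ^ 2) z + μ / 2 * ‖z - x‖ ^ 2
      ≤ objective h (fun x => g x + μ / 2 * ‖x - x₀‖ ^ 2) x := by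
  have hc := convexOn_objective hL hh hg
  obtain ⟨z, hz⟩ := exists_forall_add_quadratic_le hc (half_pos hμ) x₀
  refine ⟨z, fun x => ?_⟩
  have := add_quadratic_le_of_forall_le hc hz x
  rw [norm_sub_rev z x]
  simp only [objective] at this ⊢
  linarith

variable [NeZero n]

/-- The threshold `3/4` is where `√(mμ/(3L))` reaches `1/2` and `1/(4mμ)` equals `1/(3L)`. -/
lemma admissible_params (hm : 0 < m) (hL : 0 < L) (hμ : 0 < μ) (hh : ∀ i, SmoothConvex L (h i))
    (hψ : ConvexOn ℝ Set.univ ψ) : Admissible (params n m L μ) L h ψ := by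
  have hm' : (0 : ℝ) < m := Nat.cast_pos.2 hm
  by_cases hc : (m : ℝ) * μ / L ≤ 3 / 4
  · refine ⟨hL, ?_, ?_, ?_, ?_, rfl, hh, hψ⟩ <;> simp only [params, stepSize, momentum, if_pos hc]
    · positivity
    · positivity
    · refine Real.sqrt_le_iff.2 ⟨by norm_num, ?_⟩
      rw [div_le_iff₀ hL] at hc
      rw [div_le_iff₀ (by positivity)]
      linarith
    · exact (mul_one_div_cancel (by positivity)).le
  · refine ⟨hL, ?_, ?_, ?_, ?_, rfl, hh, hψ⟩ <;> simp only [params, stepSize, momentum, if_neg hc]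
    · positivity
    · norm_num
    · norm_num
    · rw [not_le, lt_div_iff₀ hL] at hc
      rw [mul_one_div, div_le_one (by positivity)]
      linarith

/-- In the first regime `η m μ = ω²`, so `S` is the ceiling of `4/ω - 2`. In the second it is `6`.
-/
lemma params_S_le (hm : 0 < m) (hL : 0 < L) (hμ : 0 < μ) :
    ((params n m L μ).S : ℝ) ≤ 7 + 4 * Real.sqrt (3 * L / (m * μ)) := by
  have hm' : (0 : ℝ) < m := Nat.cast_pos.2 hm
  have hsq : 0 ≤ Real.sqrt (3 * L / (m * μ)) := Real.sqrt_nonneg _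
  by_cases hc : (m : ℝ) * μ / L ≤ 3 / 4
  · simp only [params, stepSize, momentum, if_pos hc]
    set ω := Real.sqrt ((m : ℝ) * μ / (3 * L)) with hω
    have hω0 : 0 < ω := by positivity
    have hω2 : ω ^ 2 = (m : ℝ) * μ / (3 * L) := Real.sq_sqrt (by positivity)
    have h1 : 1 / (3 * L) * (m : ℝ) * μ = ω ^ 2 := by rw [hω2]; field_simp
    have h2 : Real.sqrt (3 * L / (m * μ)) = 1 / ω := by
      rw [hω, one_div, ← Real.sqrt_inv, inv_div]
    rw [h1, h2]
    have h3 : 2 * ((1 - ω) / ω + ω / ω ^ 2) = 4 * (1 / ω) - 2 := by field_simp; ring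
    rw [h3]
    have hω1 : ω ≤ 1 / 2 := by
      refine Real.sqrt_le_iff.2 ⟨by norm_num, ?_⟩
      rw [div_le_iff₀ hL] at hc
      rw [div_le_iff₀ (by positivity)]
      linarith
    have h4 : 1 ≤ 1 / ω := (one_le_div hω0).2 (by linarith)
    have := Nat.ceil_lt_add_one (by linarith : 0 ≤ 4 * (1 / ω) - 2)
    linarith
  · simp only [params, stepSize, momentum, if_neg hc]
    have h1 : 2 * ((1 - 1 / 2) / (1 / 2) + 1 / 2 / (1 / (4 * (m : ℝ) * μ) * m * μ)) = 6 := by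
      field_simp; norm_num
    rw [h1]
    have := Nat.ceil_lt_add_one (by norm_num : (0 : ℝ) ≤ 6)
    linarith

end Parameters

/-! ### Stages and total cost -/

section Stages

variable {d n m : ℕ} {f : Fin n → Vec d → ℝ} {g : Vec d → ℝ} {G : ℝ}

/-- The objective of stage `t` of adaptive regularization and smoothing. -/
noncomputable def stageObjective (f : Fin n → Vec d → ℝ) (g : Vec d → ℝ) (δ₀ σ₀ : ℝ) (x₀ : Vec d) (t : ℕ) :
    Vec d → ℝ :=
  objective (fun i => moreau (2 ^ t * δ₀) (f i)) (fun x => g x + σ₀ / 2 ^ t / 2 * ‖x - x₀‖ ^ 2)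

lemma objective_mono {f₁ f₂ : Fin n → Vec d → ℝ} {x : Vec d} (hf : ∀ i, f₁ i x ≤ f₂ i x)
    (g : Vec d → ℝ) : objective f₁ g x ≤ objective f₂ g x :=
  add_le_add_left (avg_le_of_forall_le hf) _

variable {δ₀ σ₀ : ℝ} {x₀ : Vec d}

lemma stageObjective_le (hG : ∀ i x y, |f i x - f i y| ≤ G * ‖x - y‖) (hδ : 0 < δ₀) (t : ℕ)
    (x : Vec d) :
    stageObjective f g δ₀ σ₀ x₀ t x ≤ objective f g x + σ₀ / 2 ^ t / 2 * ‖x - x₀‖ ^ 2 := by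
  have := objective_mono (fun i => moreau_le (hG i) (by positivity : 0 < 2 ^ t * δ₀) x) g
  simp only [stageObjective, objective] at this ⊢
  linarith

lemma stageObjective_le_succ (hG : ∀ i x y, |f i x - f i y| ≤ G * ‖x - y‖) (hδ : 0 < δ₀) (t : ℕ)
    (x : Vec d) :
    stageObjective f g δ₀ σ₀ x₀ t x
      ≤ stageObjective f g δ₀ σ₀ x₀ (t + 1) x + σ₀ / 2 ^ (t + 1) / 2 * ‖x - x₀‖ ^ 2 := by
  have hle : 2 ^ t * δ₀ ≤ 2 ^ (t + 1) * δ₀ := by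
    have : 0 < 2 ^ t * δ₀ := by positivity
    rw [pow_succ]; linarith
  have := objective_mono
    (fun i => moreau_mono (hG i) (by positivity : 0 < 2 ^ t * δ₀) hle x) g
  have e : σ₀ / 2 ^ t = 2 * (σ₀ / 2 ^ (t + 1)) := by rw [pow_succ]; field_simp
  simp only [stageObjective, objective, e] at this ⊢
  linarith

variable [NeZero n]

lemma le_stageObjective (hG : ∀ i x y, |f i x - f i y| ≤ G * ‖x - y‖) (hδ : 0 < δ₀) (t : ℕ)
    (x : Vec d) :
    objective f g x - G ^ 2 / (2 * (2 ^ t * δ₀)) + σ₀ / 2 ^ t / 2 * ‖x - x₀‖ ^ 2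
      ≤ stageObjective f g δ₀ σ₀ x₀ t x := by
  have := avg_le_of_forall_le (fun i => sub_le_moreau (hG i) (by positivity : 0 < 2 ^ t * δ₀) x)
  have hn : (n : ℝ) ≠ 0 := Nat.cast_ne_zero.2 (NeZero.ne n)
  rw [Finset.sum_sub_distrib, mul_sub, Finset.sum_const, Finset.card_univ, Fintype.card_fin,
    nsmul_eq_mul, ← mul_assoc, one_div_mul_cancel hn, one_mul] at this
  simp only [stageObjective, objective]
  linarith

lemma meanLE_adaptRegSmooth {Δ : ℝ} {xs : Vec d} (hm : 0 < m) (hG0 : 0 < G) (hΔ0 : 0 < Δ)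
    (hf : ∀ i, ConvexOn ℝ Set.univ (f i)) (hG : ∀ i x y, |f i x - f i y| ≤ G * ‖x - y‖)
    (hg : ConvexOn ℝ Set.univ g) (hxs : ∀ x, objective f g xs ≤ objective f g x)
    (hΔ : Δ = objective f g x₀ - objective f g xs) (hR : 0 < ‖x₀ - xs‖) (t : ℕ) :
    MeanLE (adaptRegSmooth f g m (G ^ 2 / Δ) (Δ / ‖x₀ - xs‖ ^ 2) x₀ (t + 1))
      (fun r => r.2 = ∑ k ∈ Finset.range (t + 1), 2 * ((params n m (2 ^ k * (G ^ 2 / Δ))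
        (Δ / ‖x₀ - xs‖ ^ 2 / 2 ^ k)).S * (n + 2 * m)))
      (fun r => objective f g r.1 - objective f g xs) (4 * Δ / 2 ^ (t + 1)) := by
  set δ₀ := G ^ 2 / Δ with hδ₀
  set σ₀ := Δ / ‖x₀ - xs‖ ^ 2 with hσ₀
  have hδ : 0 < δ₀ := by positivity
  have hσ : 0 < σ₀ := by positivity
  have hδt : ∀ t : ℕ, 0 < 2 ^ t * δ₀ := fun t => by positivity
  have hσt : ∀ t : ℕ, 0 < σ₀ / 2 ^ t := fun t => by positivity
  have hbias : ∀ t : ℕ, G ^ 2 / (2 * (2 ^ t * δ₀)) = Δ / 2 ^ t / 2 := fun t => by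
    rw [hδ₀]; field_simp
  have hreg : ∀ t : ℕ, σ₀ / 2 ^ t / 2 * ‖xs - x₀‖ ^ 2 = Δ / 2 ^ t / 2 := fun t => by
    rw [norm_sub_rev, hσ₀]; field_simp
  have hhalf : ∀ c : ℝ, ∀ t : ℕ, c / 2 ^ t = 2 * (c / 2 ^ (t + 1)) := fun c t => by
    rw [pow_succ]; field_simp
  have hsm : ∀ t i, SmoothConvex (2 ^ t * δ₀) (moreau (2 ^ t * δ₀) (f i)) := fun t i =>
    smoothConvex_moreau (hf i) (hG i) (hδt t)
  have hψ : ∀ t : ℕ, ConvexOn ℝ Set.univ fun x => g x + σ₀ / 2 ^ t / 2 * ‖x - x₀‖ ^ 2 := fun t =>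
    hg.add (convexOn_quadratic (half_pos (hσt t)).le x₀)
  choose z hz using fun t => exists_minimizer_objective (hδt t) (hsm t) hg (hσt t) x₀
  have hzmin : ∀ t x, stageObjective f g δ₀ σ₀ x₀ t (z t) ≤ stageObjective f g δ₀ σ₀ x₀ t x :=
    fun t x => (le_add_of_nonneg_right (by have := hσt t; positivity)).trans (hz t x)
  have hup := stageObjective_le (g := g) (σ₀ := σ₀) (x₀ := x₀) hG hδ
  have hlow := le_stageObjective (g := g) (σ₀ := σ₀) (x₀ := x₀) hG hδ
  simp only [hbias] at hlow
  have hsuc := stageObjective_le_succ (g := g) (σ₀ := σ₀) (x₀ := x₀) hG hδ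
  have hzxs : ∀ t, stageObjective f g δ₀ σ₀ x₀ t (z t) ≤ objective f g xs + Δ / 2 ^ t / 2 :=
    fun t => (hzmin t xs).trans ((hup t xs).trans_eq (by rw [hreg]))
  have hstage : ∀ t, MeanLE (adaptRegSmooth f g m δ₀ σ₀ x₀ t)
      (fun r => r.2 = ∑ k ∈ Finset.range t, 2 * ((params n m (2 ^ k * δ₀)
        (σ₀ / 2 ^ k)).S * (n + 2 * m)))
      (fun r => stageObjective f g δ₀ σ₀ x₀ t r.1 - stageObjective f g δ₀ σ₀ x₀ t (z t))
      (4 * Δ / 2 ^ t) →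
      MeanLE (adaptRegSmooth f g m δ₀ σ₀ x₀ (t + 1))
      (fun r => r.2 = ∑ k ∈ Finset.range (t + 1), 2 * ((params n m (2 ^ k * δ₀)
        (σ₀ / 2 ^ k)).S * (n + 2 * m)))
      (fun r => stageObjective f g δ₀ σ₀ x₀ t r.1 - stageObjective f g δ₀ σ₀ x₀ t (z t))
      (Δ / 2 ^ t) := by
    intro t ht
    refine ((ht.affine (r := 1 / 4) (by norm_num) 0).mono (by rw [mul_div_assoc]; linarith)).bind
      fun r hr => ?_
    refine ((meanLE_asvrg (admissible_params hm (hδt t) (hσt t) (hsm t) (hψ t)) hm rfl rfl rfl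
      (hσt t) (hz t) (Nat.le_ceil _) r).imp (fun q hq => ?_) fun q _ => le_rfl).mono
      (by simp [stageObjective])
    rw [hq, hr, Finset.sum_range_succ]
  have hall : ∀ t, MeanLE (adaptRegSmooth f g m δ₀ σ₀ x₀ t)
      (fun r => r.2 = ∑ k ∈ Finset.range t, 2 * ((params n m (2 ^ k * δ₀)
        (σ₀ / 2 ^ k)).S * (n + 2 * m)))
      (fun r => stageObjective f g δ₀ σ₀ x₀ t r.1 - stageObjective f g δ₀ σ₀ x₀ t (z t))
      (4 * Δ / 2 ^ t) := by
    intro t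
    induction t with
    | zero =>
      refine meanLE_pure (by simp) ?_
      have h1 := hup 0 x₀
      have h2 := hlow 0 (z 0)
      have h3 := hxs (z 0)
      have h4 : 0 ≤ σ₀ / 2 ^ 0 / 2 * ‖z 0 - x₀‖ ^ 2 := by positivity
      simp only [sub_self, norm_zero, ne_eq, OfNat.ofNat_ne_zero, not_false_eq_true, zero_pow,
        mul_zero, add_zero, pow_zero, div_one] at h1 h2 h4 ⊢
      linarith
    | succ t ih =>
      refine (((hstage t ih).affine zero_le_one (Δ / 2 ^ t)).mono (le_of_eq ?_)).imp
        (fun r hr => hr) fun r _ => ?_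
      -- The first goal is `Δ/2^t + Δ/2^t = 4Δ/2^(t+1)`. For the second, halving `σ` leaves `F_(t+1)
      -- ≤ F_t + Δ/2^(t+1)` at the output, and the regularizer at `z (t + 1)` is at most
      -- `Δ/2^(t+1)`, because `F_(t+1)` there is at most its bound at `xs`.
      · rw [hhalf Δ t]; ring
      · have h1 := hup (t + 1) r.1
        have h2 := hlow t r.1
        have h3 := hsuc t (z (t + 1))
        have h4 := hzxs (t + 1)
        have h5 := hlow (t + 1) (z (t + 1))
        have h6 := hxs (z (t + 1))
        have h7 := hzmin t (z (t + 1))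
        have h8 : 0 ≤ σ₀ / 2 ^ (t + 1) / 2 * ‖r.1 - x₀‖ ^ 2 := by positivity
        rw [hhalf σ₀ t] at h2
        rw [hhalf Δ t] at h2 ⊢
        linarith
  refine (((hstage t (hall t)).affine zero_le_one (Δ / 2 ^ t)).mono (le_of_eq ?_)).imp
    (fun r hr => hr) fun r _ => ?_
  · rw [hhalf Δ t]; ring
  · have h1 := hlow t r.1
    have h2 := hzxs t
    have h3 : 0 ≤ σ₀ / 2 ^ t / 2 * ‖r.1 - x₀‖ ^ 2 := by positivity
    linarith

lemma sum_calls_le {Δ R : ℝ} (hm : 0 < m) (hG : 0 < G) (hΔ : 0 < Δ) (hR : 0 < R) (T : ℕ) :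
    ((∑ k ∈ Finset.range T, 2 * ((params n m (2 ^ k * (G ^ 2 / Δ)) (Δ / R ^ 2 / 2 ^ k)).S
      * (n + 2 * m)) : ℕ) : ℝ)
      ≤ 2 * ((n : ℝ) + 2 * m) * (7 * T + 8 * (2 ^ T * (G * R / Δ) / Real.sqrt m)) := by
  have hm' : (0 : ℝ) < m := Nat.cast_pos.2 hm
  have hs : 0 < Real.sqrt m := Real.sqrt_pos.2 hm'
  have hterm : ∀ k : ℕ, ((params n m (2 ^ k * (G ^ 2 / Δ)) (Δ / R ^ 2 / 2 ^ k)).S : ℝ)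
      ≤ 7 + 2 ^ k * (8 * ((G * R / Δ) / Real.sqrt m)) := by
    intro k
    refine (params_S_le hm (by positivity) (by positivity)).trans ?_
    have h1 : Real.sqrt (3 * (2 ^ k * (G ^ 2 / Δ)) / (m * (Δ / R ^ 2 / 2 ^ k)))
        ≤ 2 * (2 ^ k * ((G * R / Δ) / Real.sqrt m)) := by
      refine Real.sqrt_le_iff.2 ⟨by positivity, ?_⟩
      have h2 : (2 * (2 ^ k * ((G * R / Δ) / Real.sqrt m))) ^ 2
          = 4 * ((2 ^ k) ^ 2 * (G ^ 2 * R ^ 2 / (Δ ^ 2 * m))) := by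
        simp only [mul_pow, div_pow, Real.sq_sqrt hm'.le]
        rw [div_div]; norm_num
      have h3 : 3 * (2 ^ k * (G ^ 2 / Δ)) / (m * (Δ / R ^ 2 / 2 ^ k))
          = 3 * ((2 ^ k) ^ 2 * (G ^ 2 * R ^ 2 / (Δ ^ 2 * m))) := by field_simp
      rw [h2, h3]
      exact mul_le_mul_of_nonneg_right (by norm_num) (by positivity)
    linarith
  have hgeom : ∑ k ∈ Finset.range T, (2 : ℝ) ^ k ≤ 2 ^ T := by
    rw [geom_sum_eq (by norm_num)]; norm_num
  push_cast
  calc ∑ k ∈ Finset.range T, 2 * (((params n m (2 ^ k * (G ^ 2 / Δ)) (Δ / R ^ 2 / 2 ^ k)).S : ℝ)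
        * ((n : ℝ) + 2 * m))
      ≤ ∑ k ∈ Finset.range T, 2 * ((7 + 2 ^ k * (8 * ((G * R / Δ) / Real.sqrt m)))
        * ((n : ℝ) + 2 * m)) := by
        refine Finset.sum_le_sum fun k _ => ?_
        have := hterm k
        gcongr
    _ = 2 * ((n : ℝ) + 2 * m) * (7 * T + (∑ k ∈ Finset.range T, 2 ^ k)
        * (8 * ((G * R / Δ) / Real.sqrt m))) := by
        rw [← Finset.mul_sum, ← Finset.sum_mul, Finset.sum_add_distrib, ← Finset.sum_mul]
        simp only [Finset.sum_const, Finset.card_range, nsmul_eq_mul]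
        ring
    _ ≤ 2 * ((n : ℝ) + 2 * m) * (7 * T + 2 ^ T * (8 * ((G * R / Δ) / Real.sqrt m))) := by
        gcongr
    _ = _ := by ring

end Stages

end ASVRG

/-! ### Stopping time and constants -/

theorem mainTheorem11 (a b κ : ℝ) (ha : 0 < a) (hab : a ≤ b) (hκ : 1 < κ) :
    ∃ C : ℝ, 0 < C ∧
      ∀ (n d m : ℕ) [NeZero n] (f : Fin n → ASVRG.Vec d → ℝ) (g : ASVRG.Vec d → ℝ)
        (G Δ ε : ℝ) (x₀ xs : ASVRG.Vec d),
        a * (n : ℝ) ≤ (m : ℝ) → (m : ℝ) ≤ b * (n : ℝ) →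
        0 < G →
        (∀ i, ConvexOn ℝ Set.univ (f i)) →
        (∀ i x y, |f i x - f i y| ≤ G * ‖x - y‖) →
        ConvexOn ℝ Set.univ g →
        (∀ x, ASVRG.objective f g xs ≤ ASVRG.objective f g x) →
        Δ = ASVRG.objective f g x₀ - ASVRG.objective f g xs →
        0 < ε → ε ≤ Δ / κ →
        let law : PMF (ASVRG.Vec d × ℕ) :=
          ASVRG.adaptRegSmooth f g m (G ^ 2 / Δ) (Δ / ‖x₀ - xs‖ ^ 2) x₀
            ⌈Real.logb 2 (4 * Δ / ε)⌉₊
        MeasureTheory.Integrable (fun z => ASVRG.objective f g z.1) law.toMeasure ∧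
        (∫ z, ASVRG.objective f g z.1 ∂law.toMeasure) - ASVRG.objective f g xs ≤ ε ∧
        ∀ z ∈ law.support,
          (z.2 : ℝ) ≤ C * ((n : ℝ) * Real.log (Δ / ε)
            + Real.sqrt (n : ℝ) * G * ‖x₀ - xs‖ / ε) := by
  have hb : 0 < b := ha.trans_le hab
  have hlogκ : 0 < Real.log κ := Real.log_pos hκ
  have hlog2 : 0 < Real.log 2 := Real.log_pos one_lt_two
  have hsa : 0 < Real.sqrt a := Real.sqrt_pos.2 ha
  refine ⟨2 * (1 + 2 * b) * (7 * (3 / Real.log κ + 1 / Real.log 2) + 64 / Real.sqrt a),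
    by positivity, ?_⟩
  intro n d m _ f g G Δ ε x₀ xs hmn hmn' hG0 hf hG hg hxs hΔ hε hεΔ law
  have hn : (0 : ℝ) < n := Nat.cast_pos.2 (NeZero.pos n)
  have hm' : (0 : ℝ) < m := (mul_pos ha hn).trans_le hmn
  have hm : 0 < m := Nat.cast_pos.1 hm'
  rw [le_div_iff₀ (by linarith)] at hεΔ
  have hΔ0 : 0 < Δ := lt_of_lt_of_le (by nlinarith) hεΔ
  have hR : 0 < ‖x₀ - xs‖ := by
    rw [norm_pos_iff, sub_ne_zero]
    rintro rfl
    linarith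
  have hκΔ : κ ≤ Δ / ε := by rwa [le_div_iff₀ hε, mul_comm]
  have h4 : 1 < 4 * Δ / ε := by rw [mul_div_assoc]; linarith
  have hlogb : 0 < Real.logb 2 (4 * Δ / ε) := Real.logb_pos one_lt_two h4
  -- At least one stage is run, since the final bound concerns the end of a stage.
  obtain ⟨t, ht⟩ : ∃ t, ⌈Real.logb 2 (4 * Δ / ε)⌉₊ = t + 1 :=
    Nat.exists_eq_succ_of_ne_zero (Nat.ceil_pos.2 hlogb).ne'
  have hTlow : Real.logb 2 (4 * Δ / ε) ≤ (t + 1 : ℕ) := ht ▸ Nat.le_ceil _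
  have hTup : ((t + 1 : ℕ) : ℝ) < Real.logb 2 (4 * Δ / ε) + 1 :=
    ht ▸ Nat.ceil_lt_add_one hlogb.le
  have hlaw : law = ASVRG.adaptRegSmooth f g m (G ^ 2 / Δ) (Δ / ‖x₀ - xs‖ ^ 2) x₀ (t + 1) := by
    simp only [law, ht]
  have hmean := ASVRG.meanLE_adaptRegSmooth hm hG0 hΔ0 hf hG hg hxs hΔ hR t
  rw [hlaw]
  refine ⟨hmean.integrable _, ?_, fun z hz => ?_⟩
  · have h1 := (hmean.affine zero_le_one (ASVRG.objective f g xs)).integral_le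
    simp only [one_mul, sub_add_cancel] at h1
    have h2 : 4 * Δ / ε ≤ 2 ^ (t + 1) := by
      rw [← Real.rpow_natCast]
      exact (Real.logb_le_iff_le_rpow one_lt_two (by positivity)).1 hTlow
    have h3 : 4 * Δ / 2 ^ (t + 1) ≤ ε := by
      rw [div_le_iff₀ (by positivity)]
      rw [div_le_iff₀ hε] at h2
      linarith
    linarith
  · rw [hmean.2.1 z hz]
    refine (ASVRG.sum_calls_le hm hG0 hΔ0 hR (t + 1)).trans ?_
    set R := ‖x₀ - xs‖
    set T := t + 1
    have h1 : (2 : ℝ) ^ T ≤ 8 * (Δ / ε) := by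
      rw [← Real.rpow_natCast]
      refine (Real.rpow_le_rpow_of_exponent_le one_le_two hTup.le).trans ?_
      rw [Real.rpow_add two_pos, Real.rpow_logb two_pos (by norm_num) (by positivity),
        Real.rpow_one]
      exact le_of_eq (by ring)
    have hlogΔ : Real.log κ ≤ Real.log (Δ / ε) := Real.log_le_log (by linarith) hκΔ
    -- `T` is below `3 + log₂(Δ/ε)`. The gap `κ > 1` keeps the logarithm away from zero, so it
    -- absorbs the `3`.
    have h2 : (T : ℝ) ≤ (3 / Real.log κ + 1 / Real.log 2) * Real.log (Δ / ε) := by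
      have h3 : Real.logb 2 (4 * Δ / ε) = 2 + Real.log (Δ / ε) / Real.log 2 := by
        rw [mul_div_assoc, Real.logb, Real.log_mul (by norm_num) (by positivity),
          show (4 : ℝ) = 2 ^ 2 by norm_num, Real.log_pow]
        field_simp
        push_cast
        ring
      have h5 : 3 ≤ 3 / Real.log κ * Real.log (Δ / ε) := by
        rw [div_mul_eq_mul_div, le_div_iff₀ hlogκ]
        linarith
      rw [h3] at hTup
      rw [add_mul, one_div_mul_eq_div]
      linarith
    have h6 : (n : ℝ) + 2 * m ≤ (1 + 2 * b) * n := by linarith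
    have h7 : Real.sqrt a * Real.sqrt n ≤ Real.sqrt m := by
      rw [← Real.sqrt_mul ha.le]
      exact Real.sqrt_le_sqrt hmn
    have hsn : 0 < Real.sqrt n := Real.sqrt_pos.2 hn
    have h8 : 2 ^ T * (G * R / Δ) / Real.sqrt m
        ≤ 8 * (Δ / ε) * (G * R / Δ) / (Real.sqrt a * Real.sqrt n) := by gcongr
    have hnn : (n : ℝ) = Real.sqrt n * Real.sqrt n := (Real.mul_self_sqrt hn.le).symm
    -- The lower bound `a n ≤ m` turns `n/√m` into a multiple of `√n`, and `Δ` cancels.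
    have h9 : n * (8 * (8 * (Δ / ε) * (G * R / Δ) / (Real.sqrt a * Real.sqrt n)))
        = 64 / Real.sqrt a * (Real.sqrt n * G * R / ε) := by
      nth_rewrite 1 [hnn]
      field_simp
      norm_num
    have hlogΔ0 : 0 ≤ Real.log (Δ / ε) := hlogκ.le.trans hlogΔ
    calc 2 * ((n : ℝ) + 2 * m) * (7 * T + 8 * (2 ^ T * (G * R / Δ) / Real.sqrt m))
        ≤ 2 * ((1 + 2 * b) * n) * (7 * ((3 / Real.log κ + 1 / Real.log 2) * Real.log (Δ / ε))
          + 8 * (8 * (Δ / ε) * (G * R / Δ) / (Real.sqrt a * Real.sqrt n))) := by gcongr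
      _ = 2 * (1 + 2 * b) * (7 * (3 / Real.log κ + 1 / Real.log 2) * (n * Real.log (Δ / ε))
          + n * (8 * (8 * (Δ / ε) * (G * R / Δ) / (Real.sqrt a * Real.sqrt n)))) := by ring
      _ = 2 * (1 + 2 * b) * (7 * (3 / Real.log κ + 1 / Real.log 2) * (n * Real.log (Δ / ε))
          + 64 / Real.sqrt a * (Real.sqrt n * G * R / ε)) := by rw [h9]
      _ ≤ _ := by
        rw [mul_assoc (2 * (1 + 2 * b)) (7 * _ + _)]
        refine mul_le_mul_of_nonneg_left ?_ (by positivity)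
        have k1 : 0 ≤ 7 * (3 / Real.log κ + 1 / Real.log 2) * (Real.sqrt n * G * R / ε) := by
          positivity
        have k2 : 0 ≤ 64 / Real.sqrt a * ((n : ℝ) * Real.log (Δ / ε)) := by positivity
        linarith
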